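/- Let $n\in\mathbb N$ and let $(H_p)_{p\in\mathbb Z}$ be (real or complex) Hilbert spaces with $H_p=0$ for $p<0$ and for $p\ge n+1$. Let $\delta_p\colon H_p\to H_{p-1}$, $p\in\mathbb Z$, be bounded linear operators (so $\delta_p=0$ for $p<0$ and for $p\ge n+1$), that is, a sequence $$0\to H_n\xrightarrow{\delta_n}H_{n-1}\to\cdots\to H_1\xrightarrow{\delta_1}H_0\to 0,$$ and assume that the range $R(\delta_p\delta_{p+1})$ is finite dimensional for each $p\in\mathbb Z$. Write $N(\cdot)$ for the null space. The sequence $(H,\delta)$ is called a Fredholm chain if the quotients $N(\delta_p)/(N(\delta_p)\cap R(\delta_{p+1}))$ and $R(\delta_{p+1})/(N(\delta_p)\cap R(\delta_{p+1}))$ are finite dimensional for $p=0,\dots,n$. Then the following statements are equivalent: (i) $(H,\delta)$ is a Fredholm chain; (ii) for each $p\in\mathbb Z$, the bounded operator $\delta_{p+1}\delta_{p+1}^*+\delta_p^*\delta_p$ on $H_p$ is a Fredholm self-adjoint operator. -/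

import Mathlib

/-- A sequence of bounded operators `δ_p : H_p → H_{p-1}`, `p ∈ ℤ`. The operator `δ_p` is
`δ p (p - 1) _`, and `δ_{p+1}` is `δ (p + 1) p _`: source and target are both arguments,
with a proof that they are consecutive, so that both have `H p` literally as an end. -/
abbrev OperatorSequence (𝕜 : Type*) [RCLike 𝕜] (H : ℤ → Type*)
    [∀ p, NormedAddCommGroup (H p)] [∀ p, InnerProductSpace 𝕜 (H p)] : Type _ :=
  ∀ p q : ℤ, q + 1 = p → (H p →L[𝕜] H q)

namespace OperatorSequence

variable {𝕜 : Type*} [RCLike 𝕜] {H : ℤ → Type*}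
  [∀ p, NormedAddCommGroup (H p)] [∀ p, InnerProductSpace 𝕜 (H p)]

/-- The operator `δ_p : H_p → H_{p-1}` leaving `H_p`. -/
def outgoing (δ : OperatorSequence 𝕜 H) (p : ℤ) : H p →L[𝕜] H (p - 1) :=
  δ p (p - 1) (sub_add_cancel p 1)

/-- The operator `δ_{p+1} : H_{p+1} → H_p` arriving at `H_p`. -/
def incoming (δ : OperatorSequence 𝕜 H) (p : ℤ) : H (p + 1) →L[𝕜] H p :=
  δ (p + 1) p rfl

/-- A sequence `0 → H_n → ⋯ → H_0 → 0` is a Fredholm chain if, for `p = 0, …, n`, the quotients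
`N(δ_p) / (N(δ_p) ∩ R(δ_{p+1}))` and `R(δ_{p+1}) / (N(δ_p) ∩ R(δ_{p+1}))`
are finite dimensional, the spaces `H_p` with `p < 0` or `p ≥ n + 1` being zero. -/
structure IsFredholmChain (δ : OperatorSequence 𝕜 H) (n : ℕ) : Prop where
  subsingleton : ∀ p : ℤ, p < 0 ∨ (n : ℤ) + 1 ≤ p → Subsingleton (H p)
  finite_ker : ∀ p : ℤ, 0 ≤ p → p ≤ n →
    FiniteDimensional 𝕜 ((δ.outgoing p).ker ⧸
      ((δ.outgoing p).ker ⊓ (δ.incoming p).range).submoduleOf (δ.outgoing p).ker)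
  finite_range : ∀ p : ℤ, 0 ≤ p → p ≤ n →
    FiniteDimensional 𝕜 ((δ.incoming p).range ⧸
      ((δ.outgoing p).ker ⊓ (δ.incoming p).range).submoduleOf (δ.incoming p).range)

end OperatorSequence

/-! Write `A = δ_{p+1}`, `B = δ_p`, `L = A A* + B* B`. Since `B A` has finite rank, the second
quotient is always finite dimensional, so being a chain means that `N(B) ⊆ R(A) + X` with `X` finite
dimensional. For a chain, `R(A)` agrees with the closed space `N(B)` up to finite dimensions, hence
is closed; likewise `R(B)`, one degree lower. Then `R(A) = R(A A* A)` and `N(B)ᗮ = R(B* B B*)`. As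
`L A - A A* A` and `L B* - B* B B*` have finite rank, `R(L)` contains `R(A)` and `N(B)ᗮ` up to
finite dimensions, so it has finite codimension, which suffices as `L` is self-adjoint. Conversely,
let `x = L w + c` lie in `N(B)`, with `c` in a finite-dimensional complement of `R(L)`. Applying `B`
confines `B* B w` to a finite-dimensional space, and `x = A A* w + (c + B* B w)`. -/

namespace Submodule

variable {K V : Type*} [DivisionRing K] [AddCommGroup V] [Module K V]

/-- The quotient `N / (N ∩ R)` is finite dimensional iff `N` is contained in `R` up to a
finite-dimensional subspace. -/
theorem finiteDimensional_quotient_inf_iff (N R : Submodule K V) :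
    FiniteDimensional K (N ⧸ (N ⊓ R).submoduleOf N) ↔
      ∃ F : Submodule K V, FiniteDimensional K F ∧ N ≤ R ⊔ F := by
  have hker : (R.mkQ ∘ₗ N.subtype).ker = (N ⊓ R).submoduleOf N := by
    ext x
    simp [submoduleOf]
  constructor
  · intro h
    obtain ⟨C, hC⟩ := exists_isCompl ((N ⊓ R).submoduleOf N)
    have : FiniteDimensional K C := .of_fg (CoFG.fg_of_isCompl hC h)
    refine ⟨C.map N.subtype, inferInstance, ?_⟩
    calc N = (⊤ : Submodule K N).map N.subtype := by simp
      _ = ((N ⊓ R).submoduleOf N).map N.subtype ⊔ C.map N.subtype := by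
        rw [← hC.sup_eq_top, map_sup]
      _ ≤ R ⊔ C.map N.subtype := by
        refine sup_le_sup_right ?_ _
        rintro _ ⟨x, hx, rfl⟩
        exact hx.2
  · rintro ⟨F, hF, hN⟩
    have hle : (R.mkQ ∘ₗ N.subtype).range ≤ F.map R.mkQ := by
      rw [LinearMap.range_comp, range_subtype]
      refine (map_mono hN).trans ?_
      rw [map_sup]
      simp
    have : FiniteDimensional K (R.mkQ ∘ₗ N.subtype).range := finiteDimensional_of_le hle
    rw [← hker]
    exact (R.mkQ ∘ₗ N.subtype).quotKerEquivRange.symm.finiteDimensional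

end Submodule

namespace LinearMap

variable {K U V W : Type*} [DivisionRing K] [AddCommGroup U] [Module K U]
  [AddCommGroup V] [Module K V] [AddCommGroup W] [Module K W]

/-- If `B ∘ A` has finite rank, then the range of `A` lies in the kernel of `B` up to a
finite-dimensional subspace. -/
theorem finiteDimensional_range_quotient_of_comp (A : U →ₗ[K] V) (B : V →ₗ[K] W)
    [h : FiniteDimensional K (B ∘ₗ A).range] :
    FiniteDimensional K (A.range ⧸ (B.ker ⊓ A.range).submoduleOf A.range) := by
  have hker : (B.domRestrict A.range).ker = (B.ker ⊓ A.range).submoduleOf A.range := by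
    ext x
    simp [Submodule.submoduleOf]
  have hrange : (B.domRestrict A.range).range = (B ∘ₗ A).range := by
    rw [range_domRestrict, range_comp]
  rw [← hker]
  rw [← hrange] at h
  exact (B.domRestrict A.range).quotKerEquivRange.symm.finiteDimensional

end LinearMap

namespace ContinuousLinearMap

variable {𝕜 E F G : Type*} [RCLike 𝕜]
  [NormedAddCommGroup E] [InnerProductSpace 𝕜 E] [CompleteSpace E]
  [NormedAddCommGroup F] [InnerProductSpace 𝕜 F] [CompleteSpace F]
  [NormedAddCommGroup G] [InnerProductSpace 𝕜 G] [CompleteSpace G]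

omit [CompleteSpace F] in
theorem range_domRestrict_orthogonal_ker (T : E →L[𝕜] F) :
    (T ∘L T.kerᗮ.subtypeL).range = T.range := by
  refine le_antisymm ?_ ?_
  · rintro _ ⟨x, rfl⟩
    exact ⟨x, rfl⟩
  · rintro _ ⟨x, rfl⟩
    have : CompleteSpace T.ker := T.isClosed_ker.completeSpace_coe
    obtain ⟨k, hk, y, hy, rfl⟩ := T.ker.exists_add_mem_mem_orthogonal x
    refine ⟨⟨y, hy⟩, ?_⟩
    have : T k = 0 := hk
    simp [this]

/-- A bounded operator whose range has finite codimension has closed range. -/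
theorem isClosed_range_of_coFG (T : E →L[𝕜] F) (h : T.range.CoFG) :
    IsClosed (T.range : Set F) := by
  obtain ⟨C, hC⟩ := Submodule.exists_isCompl T.range
  have : FiniteDimensional 𝕜 C := .of_fg (Submodule.CoFG.fg_of_isCompl hC h)
  -- Restricting to `N(T)ᗮ` keeps the range and makes the operator injective, as the closed range
  -- criterion requires.
  rw [← range_domRestrict_orthogonal_ker T] at hC ⊢
  refine closed_complemented_range_of_isCompl_of_ker_eq_bot _ C hC
    C.closed_of_finiteDimensional ?_
  rw [LinearMap.ker_eq_bot']
  rintro ⟨x, hx⟩ hTx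
  have h0 : inner 𝕜 x x = 0 := hx x hTx
  exact Subtype.ext (inner_self_eq_zero.mp h0)

/-- A bounded operator whose range agrees with a closed subspace up to finite-dimensional
subspaces has closed range. -/
theorem isClosed_range_of_le_sup (T : E →L[𝕜] F) {M X Y : Submodule 𝕜 F}
    (hM : IsClosed (M : Set F)) [FiniteDimensional 𝕜 X] [FiniteDimensional 𝕜 Y]
    (hX : M ≤ T.range ⊔ X) (hY : T.range ≤ M ⊔ Y) : IsClosed (T.range : Set F) := by
  -- Inside the closed space `N`, the range has finite codimension, because `N ≤ T.range ⊔ (X ⊔ Y)`.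
  set N := M ⊔ Y
  have hN : IsClosed (N : Set F) := Submodule.isClosed_sup_finiteDimensional _ _ hM
  have : CompleteSpace N := hN.completeSpace_coe
  let T' : E →L[𝕜] N := T.codRestrict N fun x => hY ⟨x, rfl⟩
  have hT' : T'.range = (N ⊓ T.range).submoduleOf N := by
    ext y
    simp [Submodule.submoduleOf, T', Subtype.ext_iff]
  have hco : T'.range.CoFG := by
    rw [hT']
    refine (Submodule.finiteDimensional_quotient_inf_iff N T.range).2 ⟨X ⊔ Y, inferInstance, ?_⟩
    exact sup_le (hX.trans (sup_le_sup_left le_sup_left _)) (le_sup_right.trans le_sup_right)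
  have hcl := hN.isClosedEmbedding_subtypeVal.isClosedMap _ (T'.isClosed_range_of_coFG hco)
  convert hcl using 1
  ext y
  constructor
  · rintro ⟨x, rfl⟩
    exact ⟨T' x, ⟨x, rfl⟩, rfl⟩
  · rintro ⟨_, ⟨x, rfl⟩, rfl⟩
    exact ⟨x, rfl⟩

/-- If `A` has closed range, then `A A* A` has the same range as `A`. -/
theorem exists_comp_adjoint_comp_apply_eq (A : E →L[𝕜] F) (hA : IsClosed (A.range : Set F))
    (x : E) : ∃ z, A (A.adjoint (A z)) = A x := by
  have : CompleteSpace A.range := hA.completeSpace_coe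
  let T : E →L[𝕜] A.range := A.codRestrict A.range fun x => ⟨x, rfl⟩
  have hsurj : Function.Surjective T := by
    rintro ⟨_, x, rfl⟩
    exact ⟨x, rfl⟩
  have hadj : ∀ y : A.range, T.adjoint y = A.adjoint y := fun y =>
    ext_inner_left 𝕜 fun v => by
      rw [adjoint_inner_right, adjoint_inner_right]
      rfl
  -- The open mapping theorem gives preimages of controlled norm; by duality `T*` is bounded below,
  -- so `T T*` is coercive, hence invertible.
  obtain ⟨C, hC, hpre⟩ := T.exists_preimage_norm_le hsurj
  have hbound : ∀ y : A.range, ‖y‖ ≤ C * ‖T.adjoint y‖ := by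
    intro y
    obtain ⟨v, hv, hvn⟩ := hpre y
    rcases (norm_nonneg y).eq_or_lt with h0 | h0
    · rw [← h0]
      positivity
    · refine le_of_mul_le_mul_right ?_ h0
      calc ‖y‖ * ‖y‖ = ‖inner 𝕜 y y‖ := by simp [inner_self_eq_norm_sq_to_K, sq]
        _ = ‖inner 𝕜 v (T.adjoint y)‖ := by rw [adjoint_inner_right, hv]
        _ ≤ ‖v‖ * ‖T.adjoint y‖ := norm_inner_le_norm _ _
        _ ≤ C * ‖y‖ * ‖T.adjoint y‖ := by gcongr
        _ = C * ‖T.adjoint y‖ * ‖y‖ := by ring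
  have hunit : IsUnit (T ∘L T.adjoint) := by
    refine isUnit_of_forall_le_norm_inner_map _ (c := ⟨(C ^ 2)⁻¹, by positivity⟩)
      (show (0 : ℝ) < (C ^ 2)⁻¹ by positivity) fun y => ?_
    have h1 : ‖inner 𝕜 ((T ∘L T.adjoint) y) y‖ = ‖T.adjoint y‖ ^ 2 := by
      rw [comp_apply, ← adjoint_inner_right, inner_self_eq_norm_sq_to_K]
      simp
    rw [h1]
    change ‖y‖ ^ 2 * (C ^ 2)⁻¹ ≤ _
    rw [← div_eq_mul_inv, div_le_iff₀ (by positivity), ← mul_pow, mul_comm _ C]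
    exact pow_le_pow_left₀ (norm_nonneg _) (hbound y) 2
  obtain ⟨y, hy⟩ := (isUnit_iff_bijective.1 hunit).2 (T x)
  obtain ⟨z, rfl⟩ := hsurj y
  refine ⟨z, ?_⟩
  have := congrArg Subtype.val hy
  rw [comp_apply, hadj] at this
  exact this

/-- If `B` has closed range, every vector orthogonal to its kernel lies in the range of
`B* B B*`. -/
theorem exists_adjoint_comp_adjoint_apply_eq (B : F →L[𝕜] G) (hB : IsClosed (B.range : Set G))
    {y : F} (hy : y ∈ B.kerᗮ) : ∃ w, B.adjoint (B (B.adjoint w)) = y := by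
  obtain ⟨z, hz⟩ := B.exists_comp_adjoint_comp_apply_eq hB y
  obtain ⟨w, hw⟩ := B.exists_comp_adjoint_comp_apply_eq hB z
  refine ⟨B w, ?_⟩
  rw [hw]
  -- `B* B z - y` lies in both `N(B)` and `N(B)ᗮ`, so it vanishes.
  have hadj : B.adjoint (B z) ∈ B.kerᗮ := by
    rw [orthogonal_ker]
    exact Submodule.le_topologicalClosure _ ⟨_, rfl⟩
  have hmem : B.adjoint (B z) - y ∈ B.ker := by
    simp [hz]
  have h0 := (B.kerᗮ.sub_mem hadj hy) _ hmem
  exact sub_eq_zero.mp (inner_self_eq_zero.mp h0)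

/-- The adjoint of a finite-rank operator has finite rank. -/
theorem finiteDimensional_range_adjoint (T : E →L[𝕜] F) [FiniteDimensional 𝕜 T.range] :
    FiniteDimensional 𝕜 T.adjoint.range := by
  have hle : T.adjoint.range ≤ T.range.map (T.adjoint : F →ₗ[𝕜] E) := by
    rintro _ ⟨y, rfl⟩
    obtain ⟨u, hu, v, hv, rfl⟩ := T.range.exists_add_mem_mem_orthogonal y
    rw [orthogonal_range] at hv
    have hv0 : T.adjoint v = 0 := hv
    exact ⟨u, hu, by simp [hv0]⟩
  exact Submodule.finiteDimensional_of_le hle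

/-- A self-adjoint operator whose range has finite codimension is Fredholm. -/
theorem isFredholm_of_isSelfAdjoint_of_coFG {T : E →L[𝕜] E} (hT : IsSelfAdjoint T)
    (h : T.range.CoFG) : T.IsFredholm := by
  have hcl := T.isClosed_range_of_coFG h
  have : CompleteSpace T.range := hcl.completeSpace_coe
  -- By self-adjointness, `N(T) = R(T)ᗮ` is a complement of the range.
  have hker : FiniteDimensional 𝕜 T.ker := by
    rw [← hT.adjoint_eq, ← orthogonal_range]
    exact .of_fg (Submodule.CoFG.fg_of_isCompl T.range.isCompl_orthogonal h)
  refine ⟨?_, hcl, hker, h, .of_finiteDimensional _⟩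
  let T' : E →L[𝕜] T.range := T.codRestrict T.range fun x => ⟨x, rfl⟩
  have hsurj : Function.Surjective T' := by
    rintro ⟨_, x, rfl⟩
    exact ⟨x, rfl⟩
  exact T'.isQuotientMap hsurj

theorem isSelfAdjoint_comp_adjoint_add_adjoint_comp (A : E →L[𝕜] F) (B : F →L[𝕜] G) :
    IsSelfAdjoint (A ∘L A.adjoint + B.adjoint ∘L B) := by
  rw [isSelfAdjoint_iff']
  simp [adjoint_comp]

/-- If `B A` has finite rank, `A` and `B` have closed range and `N(B)` lies in `R(A)` up to a
finite-dimensional subspace, then the Laplacian `A A* + B* B` is Fredholm. -/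
theorem isFredholm_comp_adjoint_add_adjoint_comp (A : E →L[𝕜] F) (B : F →L[𝕜] G)
    [FiniteDimensional 𝕜 (B ∘L A).range] (hA : IsClosed (A.range : Set F))
    (hB : IsClosed (B.range : Set G)) {X : Submodule 𝕜 F} [FiniteDimensional 𝕜 X]
    (hX : B.ker ≤ A.range ⊔ X) :
    (A ∘L A.adjoint + B.adjoint ∘L B).IsFredholm := by
  refine isFredholm_of_isSelfAdjoint_of_coFG (isSelfAdjoint_comp_adjoint_add_adjoint_comp A B) ?_
  set L := A ∘L A.adjoint + B.adjoint ∘L B with hL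
  have := (B ∘L A).finiteDimensional_range_adjoint
  let Y : Submodule 𝕜 F := (B ∘L A).range.map (B.adjoint : G →ₗ[𝕜] F)
  let Z : Submodule 𝕜 F := (B ∘L A).adjoint.range.map (A : E →ₗ[𝕜] F)
  let W : Submodule 𝕜 F := X ⊔ (Y ⊔ Z)
  have hYW : Y ≤ W := le_sup_left.trans le_sup_right
  have hZW : Z ≤ W := le_sup_right.trans le_sup_right
  have hAL : A.range ≤ L.range ⊔ W := by
    rintro _ ⟨x, rfl⟩
    obtain ⟨z, hz⟩ := A.exists_comp_adjoint_comp_apply_eq hA x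
    -- `L A z = A x + B* (B A) z`, and the last term lies in `Y`.
    refine Submodule.mem_sup.2 ⟨L (A z), ⟨_, rfl⟩, -B.adjoint (B (A z)),
      W.neg_mem (hYW ⟨_, ⟨z, rfl⟩, rfl⟩), ?_⟩
    simp [hL, hz]
  have hBL : B.kerᗮ ≤ L.range ⊔ W := by
    intro y hy
    obtain ⟨w, hw⟩ := B.exists_adjoint_comp_adjoint_apply_eq hB hy
    refine Submodule.mem_sup.2 ⟨L (B.adjoint w), ⟨_, rfl⟩, -A (A.adjoint (B.adjoint w)),
      W.neg_mem (hZW ⟨_, ⟨w, rfl⟩, ?_⟩), ?_⟩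
    · simp [adjoint_comp]
    · simp [hL, hw]
  have : CompleteSpace B.ker := B.isClosed_ker.completeSpace_coe
  have htop : W ⊔ L.range = ⊤ := by
    rw [sup_comm, eq_top_iff, ← B.ker.sup_orthogonal_of_hasOrthogonalProjection]
    exact sup_le (hX.trans (sup_le hAL (le_sup_left.trans le_sup_right))) hBL
  have hW : FiniteDimensional 𝕜 W := inferInstance
  exact (W.fg_iff_finiteDimensional.2 hW).cofg_of_codisjoint (codisjoint_iff.2 htop)

/-- If `B A` has finite rank and the range of `A A* + B* B` has finite codimension, then `N(B)`
lies in `R(A)` up to a finite-dimensional subspace. -/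
theorem exists_ker_le_range_sup (A : E →L[𝕜] F) (B : F →L[𝕜] G)
    [FiniteDimensional 𝕜 (B ∘L A).range] (h : (A ∘L A.adjoint + B.adjoint ∘L B).range.CoFG) :
    ∃ X : Submodule 𝕜 F, FiniteDimensional 𝕜 X ∧ B.ker ≤ A.range ⊔ X := by
  obtain ⟨C, hC⟩ := Submodule.exists_isCompl (A ∘L A.adjoint + B.adjoint ∘L B).range
  have : FiniteDimensional 𝕜 C := .of_fg (Submodule.CoFG.fg_of_isCompl hC h)
  let Y : Submodule 𝕜 G := (B ∘L A).range ⊔ C.map (B : F →ₗ[𝕜] G)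
  let Z : Submodule 𝕜 F := Y.comap (B : F →ₗ[𝕜] G) ⊓ B.kerᗮ
  have hZ : FiniteDimensional 𝕜 Z := by
    let f : Z →ₗ[𝕜] Y := (B : F →ₗ[𝕜] G).restrict fun x hx => hx.1
    -- `B` is injective on `N(B)ᗮ`, so `Z` embeds in the finite-dimensional `Y`.
    refine FiniteDimensional.of_injective f ((injective_iff_map_eq_zero f).2 ?_)
    rintro ⟨x, hx⟩ hfx
    have hBx : x ∈ B.ker := congrArg Subtype.val hfx
    exact Subtype.ext (inner_self_eq_zero.mp (hx.2 x hBx))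
  refine ⟨C ⊔ Z, inferInstance, fun x hx => ?_⟩
  have hBx : B x = 0 := hx
  obtain ⟨_, ⟨w, rfl⟩, c, hc, rfl⟩ :=
    Submodule.mem_sup.1 (hC.sup_eq_top ▸ Submodule.mem_top (x := x))
  have hw : B.adjoint (B w) ∈ Z := by
    refine ⟨?_, ?_⟩
    -- Solve `0 = B x = B A A* w + B B* B w + B c` for `B B* B w`.
    · refine Submodule.mem_sup.2 ⟨-B (A (A.adjoint w)),
        Submodule.neg_mem _ ⟨_, rfl⟩, -B c, Submodule.neg_mem _ ⟨c, hc, rfl⟩, ?_⟩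
      simp only [coe_coe, add_apply, comp_apply, map_add] at hBx ⊢
      linear_combination (norm := module) -hBx
    · rw [orthogonal_ker]
      exact Submodule.le_topologicalClosure _ ⟨_, rfl⟩
  refine Submodule.mem_sup.2 ⟨A (A.adjoint w), ⟨_, rfl⟩, c + B.adjoint (B w),
    Submodule.add_mem_sup hc hw, ?_⟩
  simp only [coe_coe, add_apply, comp_apply]
  abel

end ContinuousLinearMap

namespace OperatorSequence

variable {𝕜 : Type*} [RCLike 𝕜] {H : ℤ → Type*}
  [∀ p, NormedAddCommGroup (H p)] [∀ p, InnerProductSpace 𝕜 (H p)]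

theorem exists_ker_outgoing_le {δ : OperatorSequence 𝕜 H} {n : ℕ} (h : δ.IsFredholmChain n)
    (p : ℤ) : ∃ X : Submodule 𝕜 (H p),
      FiniteDimensional 𝕜 X ∧ (δ.outgoing p).ker ≤ (δ.incoming p).range ⊔ X := by
  by_cases hp : 0 ≤ p ∧ p ≤ n
  · exact (Submodule.finiteDimensional_quotient_inf_iff _ _).1 (h.finite_ker p hp.1 hp.2)
  · have := h.subsingleton p (by omega)
    exact ⟨⊥, inferInstance, (Subsingleton.elim _ _).le⟩

variable [∀ p, CompleteSpace (H p)]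

/-- Arbitrary consecutive indices let this serve both `δ_{p+1}` and `δ_p`. -/
theorem isClosed_range_of_isFredholmChain {δ : OperatorSequence 𝕜 H} {n : ℕ}
    (h : δ.IsFredholmChain n) (p q : ℤ) (hpq : q + 1 = p) :
    IsClosed ((δ p q hpq).range : Set (H q)) := by
  subst hpq
  by_cases hq : 0 ≤ q ∧ q ≤ n
  · obtain ⟨X, hX, hkX⟩ := exists_ker_outgoing_le h q
    have hfin := h.finite_range q hq.1 hq.2
    rw [inf_comm] at hfin
    obtain ⟨Y, hY, hrY⟩ := (Submodule.finiteDimensional_quotient_inf_iff _ _).1 hfin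
    exact (δ.incoming q).isClosed_range_of_le_sup (δ.outgoing q).isClosed_ker hkX hrY
  · have := h.subsingleton q (by omega)
    exact (Set.toFinite _).isClosed

end OperatorSequence

theorem theorem6p1 {𝕜 : Type*} [RCLike 𝕜] {H : ℤ → Type*}
    [∀ p, NormedAddCommGroup (H p)] [∀ p, InnerProductSpace 𝕜 (H p)] [∀ p, CompleteSpace (H p)]
    (n : ℕ) (hH : ∀ p : ℤ, p < 0 ∨ (n : ℤ) + 1 ≤ p → Subsingleton (H p))
    (δ : OperatorSequence 𝕜 H)
    (hfin : ∀ p : ℤ, FiniteDimensional 𝕜 (δ.outgoing p ∘L δ.incoming p).range) :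
    δ.IsFredholmChain n ↔
      ∀ p : ℤ,
        (δ.incoming p ∘L (δ.incoming p).adjoint +
          (δ.outgoing p).adjoint ∘L δ.outgoing p).IsFredholm ∧
        IsSelfAdjoint (δ.incoming p ∘L (δ.incoming p).adjoint +
          (δ.outgoing p).adjoint ∘L δ.outgoing p) := by
  constructor
  · intro h p
    refine ⟨?_, ContinuousLinearMap.isSelfAdjoint_comp_adjoint_add_adjoint_comp _ _⟩
    obtain ⟨X, hX, hkX⟩ := OperatorSequence.exists_ker_outgoing_le h p
    have := hfin p
    exact ContinuousLinearMap.isFredholm_comp_adjoint_add_adjoint_comp _ _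
      (OperatorSequence.isClosed_range_of_isFredholmChain h _ _ _)
      (OperatorSequence.isClosed_range_of_isFredholmChain h _ _ _) hkX
  · intro h
    refine ⟨hH, fun p _ _ => ?_, fun p _ _ => ?_⟩
    · have := hfin p
      exact (Submodule.finiteDimensional_quotient_inf_iff _ _).2
        (ContinuousLinearMap.exists_ker_le_range_sup _ _ (h p).1.finite_coker)
    · have : FiniteDimensional 𝕜
          ((δ.outgoing p : H p →ₗ[𝕜] H (p - 1)) ∘ₗ
            (δ.incoming p : H (p + 1) →ₗ[𝕜] H p)).range := hfin p
      exact LinearMap.finiteDimensional_range_quotient_of_comp _ _
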